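/- A bounded hoop is an algebra $\langle A,\wedge,\cdot,\to,0,1\rangle$ such that $\langle A,\wedge\rangle$ is a meet-semilattice with least element $0$ and largest element $1$, $\langle A,\cdot,1\rangle$ is a commutative monoid, $a\cdot b\le c$ if and only if $a\le b\to c$ for all $a,b,c\in A$, and $x\cdot(x\to y)=y\cdot(y\to x)$ for all $x,y\in A$. A BL-algebra is an algebra $\langle A,\wedge,\vee,\cdot,\to,0,1\rangle$ such that $\langle A,\wedge,\vee\rangle$ is a lattice, $\langle A,\wedge,\cdot,\to,0,1\rangle$ is a bounded hoop, and $(x\to y)\vee(y\to x)=1$ for all $x,y\in A$. Homomorphisms preserve all the operations, including both constants, and $\mathbf 2$ denotes the two-element Boolean algebra, regarded as a bounded hoop or as a BL-algebra. An algebra $\mathbf A$ is projective in a class $\mathsf K$ of algebras if $\mathbf A\in\mathsf K$ and, for all $\mathbf B,\mathbf C\in\mathsf K$, every homomorphism $h:\mathbf A\to\mathbf C$ and every surjective homomorphism $g:\mathbf B\to\mathbf C$, there is a homomorphism $f:\mathbf A\to\mathbf B$ with $gf=h$. It is finitely projective in a variety $\mathsf V$ if it is projective in the class of finite members of $\mathsf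 V$. A variety is the class of all algebras (of a given signature) satisfying some set of identities; it is locally finite if each of its finitely generated members is finite, and nontrivial if it has a member with more than one element. Theorem. 1. A finite bounded hoop $\mathbf A$ is finitely projective in the variety of all bounded hoops if and only if there is a homomorphism from $\mathbf A$ onto $\mathbf 2$. 2. Let $\mathsf V$ be a nontrivial locally finite variety of bounded hoops. A finite algebra $\mathbf A\in\mathsf V$ is projective in $\mathsf V$ if and only if there is a homomorphism from $\mathbf A$ onto $\mathbf 2$. 3. Let $\mathsf V$ be a nontrivial locally finite variety of BL-algebras. A finite algebra $\mathbf A\in\mathsf V$ is projective in $\mathsf V$ if and only if there is a homomorphism from $\mathbf A$ onto $\mathbf 2$. -/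

import Mathlib

open FirstOrder CategoryTheory

universe u

/-! ### Universal algebra: identities, varieties, local finiteness, projectivity

An algebra of a signature `L` is an `L`-structure; classes of algebras are sets of bundled
structures, and homomorphisms are Mathlib's `A →[L] B`. The signatures below have no relation
symbols. -/

namespace UnivAlg

variable {L : FirstOrder.Language.{0, 0}}

/-- The algebra `A` satisfies the identity `s ≈ t` between terms in countably many variables. -/
def SatisfiesId (A : Bundled.{u} L.Structure) (e : L.Term ℕ × L.Term ℕ) : Prop :=
  ∀ v : ℕ → A, e.1.realize v = e.2.realize v

/-- A variety is the class of all algebras satisfying some set of identities. -/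
def IsVariety (V : Set (Bundled.{u} L.Structure)) : Prop :=
  ∃ E : Set (L.Term ℕ × L.Term ℕ), V = {A | ∀ e ∈ E, SatisfiesId A e}

/-- A class is locally finite if all its finitely generated members are finite. -/
def IsLocallyFinite (V : Set (Bundled.{u} L.Structure)) : Prop :=
  ∀ A ∈ V, FirstOrder.Language.Structure.FG L A → Finite A

/-- `A` is projective in the class `K`: it belongs to `K`, and every homomorphism from `A` to a
member of `K` lifts along every surjective homomorphism between members of `K`. -/
def IsProjectiveIn (K : Set (Bundled.{u} L.Structure)) (A : Bundled.{u} L.Structure) : Prop :=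
  A ∈ K ∧ ∀ B ∈ K, ∀ C ∈ K, ∀ (h : A →[L] C) (g : B →[L] C), Function.Surjective g →
    ∃ f : A →[L] B, ∀ a, g (f a) = h a

/-- `A` is finitely projective in `V`: it is projective in the class of finite members of `V`. -/
def IsFinitelyProjectiveIn (V : Set (Bundled.{u} L.Structure))
    (A : Bundled.{u} L.Structure) : Prop :=
  IsProjectiveIn {B | B ∈ V ∧ Finite B} A

end UnivAlg

/-! ### Bounded hoops and BL-algebras -/

namespace Hoop

/-- The laws of a bounded commutative integral residuated meet-semilattice satisfying
divisibility. The order is that of the semilattice: `a ≤ b` means `inf a b = a`. -/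
structure BoundedHoopLaws {A : Type u} (inf mul imp : A → A → A) (zero one : A) : Prop where
  inf_assoc : ∀ a b c, inf (inf a b) c = inf a (inf b c)
  inf_comm : ∀ a b, inf a b = inf b a
  inf_idem : ∀ a, inf a a = a
  le_one : ∀ a, inf a one = a
  zero_le : ∀ a, inf zero a = zero
  mul_assoc : ∀ a b c, mul (mul a b) c = mul a (mul b c)
  mul_comm : ∀ a b, mul a b = mul b a
  mul_one : ∀ a, mul a one = a
  residuation : ∀ a b c, inf (mul a b) c = mul a b ↔ inf a (imp b c) = a
  divisibility : ∀ a b, mul a (imp a b) = mul b (imp b a)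

/-- The laws of a BL-algebra: a bounded commutative integral residuated lattice satisfying
divisibility and prelinearity. -/
structure BLLaws {A : Type u} (inf sup mul imp : A → A → A) (zero one : A) : Prop
    extends BoundedHoopLaws inf mul imp zero one where
  sup_assoc : ∀ a b c, sup (sup a b) c = sup a (sup b c)
  sup_comm : ∀ a b, sup a b = sup b a
  inf_sup_self : ∀ a b, inf a (sup a b) = a
  sup_inf_self : ∀ a b, sup a (inf a b) = a
  prelinearity : ∀ a b, sup (imp a b) (imp b a) = one

/-- The operation symbols of bounded hoops. -/
inductive HoopFun : ℕ → Type
  | zero : HoopFun 0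
  | one : HoopFun 0
  | inf : HoopFun 2
  | mul : HoopFun 2
  | imp : HoopFun 2

/-- The operation symbols of BL-algebras. -/
inductive BLFun : ℕ → Type
  | zero : BLFun 0
  | one : BLFun 0
  | inf : BLFun 2
  | sup : BLFun 2
  | mul : BLFun 2
  | imp : BLFun 2

/-- The signature of bounded hoops. -/
def hoopLang : FirstOrder.Language.{0, 0} := ⟨HoopFun, fun _ => Empty⟩

/-- The signature of BL-algebras. -/
def blLang : FirstOrder.Language.{0, 0} := ⟨BLFun, fun _ => Empty⟩

/-- The binary operation on `A` that a binary symbol `s` of `L` denotes. -/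
def op₂ {L : FirstOrder.Language.{0, 0}} (A : Type u) [L.Structure A] (s : L.Functions 2) (a b : A) : A :=
  FirstOrder.Language.Structure.funMap s ![a, b]

/-- The element of `A` that a constant symbol `s` of `L` denotes. -/
def op₀ {L : FirstOrder.Language.{0, 0}} (A : Type u) [L.Structure A] (s : L.Functions 0) : A :=
  FirstOrder.Language.Structure.funMap s ![]

/-- The class of all bounded hoops. -/
def boundedHoops : Set (Bundled.{u} hoopLang.Structure) :=
  {A | BoundedHoopLaws (op₂ (L := hoopLang) A HoopFun.inf) (op₂ (L := hoopLang) A HoopFun.mul)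
    (op₂ (L := hoopLang) A HoopFun.imp)
    (op₀ (L := hoopLang) A HoopFun.zero) (op₀ (L := hoopLang) A HoopFun.one)}

/-- The class of all BL-algebras. -/
def blAlgebras : Set (Bundled.{u} blLang.Structure) :=
  {A | BLLaws (op₂ (L := blLang) A BLFun.inf) (op₂ (L := blLang) A BLFun.sup)
    (op₂ (L := blLang) A BLFun.mul) (op₂ (L := blLang) A BLFun.imp)
    (op₀ (L := blLang) A BLFun.zero) (op₀ (L := blLang) A BLFun.one)}

/-- The two-element Boolean algebra `𝟐`, as a bounded hoop. -/
instance twoHoop : hoopLang.Structure Bool where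
  funMap {_} s x := match s, x with
    | HoopFun.zero, _ => false
    | HoopFun.one, _ => true
    | HoopFun.inf, x => x 0 && x 1
    | HoopFun.mul, x => x 0 && x 1
    | HoopFun.imp, x => !(x 0) || x 1
  RelMap r _ := r.elim

/-- The two-element Boolean algebra `𝟐`, as a BL-algebra. -/
instance twoBL : blLang.Structure Bool where
  funMap {_} s x := match s, x with
    | BLFun.zero, _ => false
    | BLFun.one, _ => true
    | BLFun.inf, x => x 0 && x 1
    | BLFun.sup, x => x 0 || x 1
    | BLFun.mul, x => x 0 && x 1
    | BLFun.imp, x => !(x 0) || x 1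
  RelMap r _ := r.elim

end Hoop

open UnivAlg Hoop

/-- Bounded hoops, with the meet left implicit in the order. -/
class BddHoop (A : Type u) extends CommMonoid A, PartialOrder A, HImp A, Bot A where
  le_one (a : A) : a ≤ 1
  bot_le (a : A) : ⊥ ≤ a
  mul_le_iff (a b c : A) : a * b ≤ c ↔ a ≤ b ⇨ c
  mul_himp_comm (a b : A) : a * (a ⇨ b) = b * (b ⇨ a)

namespace BddHoop

section Arithmetic

variable {A : Type u} [BddHoop A] {a b c q u v : A}

lemma le_himp (h : a * b ≤ c) : a ≤ b ⇨ c := (mul_le_iff a b c).1 h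

lemma mul_le_of_le_himp (h : a ≤ b ⇨ c) : a * b ≤ c := (mul_le_iff a b c).2 h

lemma mul_le_mul_right (h : a ≤ b) (c : A) : a * c ≤ b * c :=
  mul_le_of_le_himp (h.trans (le_himp le_rfl))

lemma mul_le_mul_left (h : a ≤ b) (c : A) : c * a ≤ c * b := by
  rw [mul_comm c a, mul_comm c b]; exact mul_le_mul_right h c

lemma mul_le_left (a b : A) : a * b ≤ a := by
  simpa using mul_le_mul_left (le_one b) a

lemma mul_le_right (a b : A) : a * b ≤ b := by
  simpa using mul_le_mul_right (le_one a) b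

lemma himp_mul_le (a b : A) : (a ⇨ b) * a ≤ b := mul_le_of_le_himp le_rfl

lemma le_himp_self (a b : A) : b ≤ a ⇨ b := le_himp (mul_le_left b a)

lemma himp_eq_one_iff : a ⇨ b = 1 ↔ a ≤ b := by
  refine ⟨fun h => ?_, fun h => le_antisymm (le_one _) (le_himp (by simpa using h))⟩
  simpa using mul_le_of_le_himp h.ge

lemma himp_self (a : A) : a ⇨ a = 1 := himp_eq_one_iff.2 le_rfl

lemma one_himp (a : A) : 1 ⇨ a = a :=
  le_antisymm (by simpa using himp_mul_le 1 a) (le_himp_self 1 a)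

lemma himp_mono_right (h : b ≤ c) (a : A) : a ⇨ b ≤ a ⇨ c :=
  le_himp ((himp_mul_le a b).trans h)

lemma mul_himp (a b c : A) : (a * b) ⇨ c = a ⇨ (b ⇨ c) := by
  apply le_antisymm
  · refine le_himp (le_himp ?_)
    rw [mul_assoc]; exact himp_mul_le _ _
  · refine le_himp ?_
    rw [← mul_assoc]
    exact mul_le_of_le_himp (himp_mul_le _ _)

lemma himp_left_comm (a b c : A) : a ⇨ (b ⇨ c) = b ⇨ (a ⇨ c) := by
  rw [← mul_himp, mul_comm, mul_himp]

lemma mul_himp_of_le (h : b ≤ a) : a * (a ⇨ b) = b := by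
  rw [mul_himp_comm, himp_eq_one_iff.2 h, mul_one]

lemma pow_himp_eq (h : q ⇨ u = u) (n : ℕ) : q ^ n ⇨ u = u := by
  induction n with
  | zero => simp [one_himp]
  | succ n ih => rw [pow_succ, mul_himp, h, ih]

lemma eq_or_eq_one_of_maximal (hq : Maximal (· ≠ 1) q) (h : q ≤ a) : a = q ∨ a = 1 := by
  by_cases h1 : a = 1
  · exact Or.inr h1
  · exact Or.inl (le_antisymm (hq.2 h1 h) h)

lemma himp_mul_eq_of_le (hu : q ⇨ u = u) (h : u ≤ q) : q ⇨ (u * v) = u * v := by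
  have hqu : u * q = u := by
    have := mul_himp_of_le h
    rwa [hu, mul_comm] at this
  have hd : q ⇨ (u * v) ≤ u := by
    simpa [hu] using himp_mono_right (mul_le_left u v) q
  rw [← mul_himp_of_le hd, ← mul_himp, hqu, mul_himp_of_le (mul_le_left u v)]

lemma himp_mul_eq (hq : Maximal (· ≠ 1) q) (hu : q ⇨ u = u) (hv : q ⇨ v = v) :
    q ⇨ (u * v) = u * v := by
  rcases eq_or_eq_one_of_maximal hq (le_himp_self u q) with huq | huq
  swap
  · exact himp_mul_eq_of_le hu (himp_eq_one_iff.1 huq)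
  rcases eq_or_eq_one_of_maximal hq (le_himp_self v q) with hvq | hvq
  swap
  · rw [mul_comm]; exact himp_mul_eq_of_le hv (himp_eq_one_iff.1 hvq)
  have huv : (u * v) ⇨ q = q := by rw [mul_himp, hvq, huq]
  have hle : u * v ≤ q ⇨ (u * v) := le_himp_self _ _
  have hr : q ≤ (q ⇨ (u * v)) ⇨ (u * v) := le_himp (by rw [mul_comm]; exact himp_mul_le _ _)
  rcases eq_or_eq_one_of_maximal hq hr with hr | hr
  · have := mul_himp_of_le hle
    rw [hr] at this
    have h1 : u * v ≤ q := this ▸ mul_le_right _ _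
    exact absurd (huv.symm.trans (himp_eq_one_iff.2 h1)) hq.1
  · exact le_antisymm (himp_eq_one_iff.1 hr) hle

lemma himp_himp_eq (hv : q ⇨ v = v) (u : A) : q ⇨ (u ⇨ v) = u ⇨ v := by
  rw [himp_left_comm, hv]

lemma exists_pow_absorbing [Finite A] (q : A) : ∃ n : ℕ, q * q ^ n = q ^ n := by
  obtain ⟨i, j, hij, h⟩ := Finite.exists_ne_map_eq_of_infinite (fun n : ℕ => q ^ n)
  wlog hlt : i < j generalizing i j
  · exact this j i hij.symm h.symm (by omega)
  refine ⟨i, le_antisymm (mul_le_right _ _) ?_⟩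
  obtain ⟨k, rfl⟩ := Nat.exists_eq_add_of_lt hlt
  calc q ^ i = q ^ (i + k + 1) := h
    _ = q ^ k * (q * q ^ i) := by
      rw [← pow_succ', ← pow_add]; congr 1; omega
    _ ≤ q * q ^ i := mul_le_right _ _

lemma pow_mul_eq_of_mul_eq {e : A} (h : q * e = e) (n : ℕ) : q ^ n * e = e := by
  induction n with
  | zero => simp
  | succ n ih => rw [pow_succ, mul_assoc, h, ih]

/-- The elements above a power of a coatom form a chain-like filter: below `1` they lie below that
coatom. -/
lemma le_of_pow_le [Finite A] (hq : Maximal (· ≠ 1) q) {n : ℕ} (h : q ^ n ≤ a) (ha : a ≠ 1) :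
    a ≤ q := by
  obtain ⟨p, hap, hp⟩ := (Set.toFinite {x : A | x ≠ 1}).exists_le_maximal ha
  have hp' : Maximal (· ≠ 1) p := hp
  rcases eq_or_eq_one_of_maximal hp' (le_himp_self q p) with h1 | h1
  · have := pow_himp_eq h1 n
    rw [himp_eq_one_iff.2 (h.trans hap)] at this
    exact absurd this.symm hp'.1
  · have hqp := himp_eq_one_iff.1 h1
    exact hap.trans (hq.2 hp'.1 hqp)

end Arithmetic

/-- Maps preserving product, residual and both constants. -/
structure IsHom {A B : Type*} [Mul A] [HImp A] [Bot A] [One A] [Mul B] [HImp B] [Bot B] [One B]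
    (f : A → B) : Prop where
  map_mul (a b : A) : f (a * b) = f a * f b
  map_himp (a b : A) : f (a ⇨ b) = f a ⇨ f b
  map_bot : f ⊥ = ⊥
  map_one : f 1 = 1

/-- The fixed elements of `q ⇨ ·` for a coatom `q`, with least element `q ^ n ⇨ ⊥`. -/
def FixedBy {B : Type u} [BddHoop B] (q : B) : Type u := {u : B // q ⇨ u = u}

/-- The fixed elements of `q ⇨ ·` form a bounded hoop. -/
@[reducible] def fixedBy {B : Type u} [BddHoop B] {q : B} (hq : Maximal (· ≠ 1) q) {n : ℕ}
    (hn : q * q ^ n = q ^ n) : BddHoop (FixedBy q) where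
  mul u v := ⟨u.1 * v.1, himp_mul_eq hq u.2 v.2⟩
  one := ⟨1, himp_eq_one_iff.2 (le_one _)⟩
  mul_assoc u v w := Subtype.ext (mul_assoc u.1 v.1 w.1)
  one_mul u := Subtype.ext (one_mul u.1)
  mul_one u := Subtype.ext (mul_one u.1)
  mul_comm u v := Subtype.ext (mul_comm u.1 v.1)
  le u v := u.1 ≤ v.1
  le_refl u := le_refl u.1
  le_trans _ _ _ := le_trans (α := B)
  le_antisymm _ _ h h' := Subtype.ext (le_antisymm h h')
  himp u v := ⟨u.1 ⇨ v.1, himp_himp_eq v.2 u.1⟩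
  bot := ⟨q ^ n ⇨ ⊥, by rw [← mul_himp, hn]⟩
  le_one u := le_one u.1
  bot_le u := by
    have := himp_mono_right (bot_le u.1) (q ^ n)
    rwa [pow_himp_eq u.2] at this
  mul_le_iff u v w := mul_le_iff u.1 v.1 w.1
  mul_himp_comm u v := Subtype.ext (mul_himp_comm u.1 v.1)

section Lifting

variable {A C : Type*} [Mul A] [HImp A] [Bot A] [One A] [Mul C] [HImp C] [Bot C] [One C]

lemma exists_maximal_of_not_injective {B : Type u} [BddHoop B] [Finite B] {g : B → C}
    (hg : IsHom g) (hi : ¬ Function.Injective g) : ∃ q : B, Maximal (· ≠ 1) q ∧ g q = 1 := by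
  obtain ⟨a, b, hab, hne⟩ : ∃ a b, g a = g b ∧ ¬ a ≤ b := by
    by_contra! hcon
    exact hi fun a b h => le_antisymm (hcon a b h) (hcon b a h.symm)
  have h1 : a ⇨ b ≠ 1 := fun h => hne (himp_eq_one_iff.1 h)
  have hg1 : g (a ⇨ b) = 1 := by
    rw [hg.map_himp, ← hab, ← hg.map_himp, himp_self, hg.map_one]
  obtain ⟨q, hle, hq⟩ := (Set.toFinite {x : B | x ≠ 1}).exists_le_maximal h1
  refine ⟨q, hq, ?_⟩
  calc g q = g 1 ⇨ g q := by rw [← hg.map_himp, one_himp]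
    _ = g (a ⇨ b) ⇨ g q := by rw [hg1, hg.map_one]
    _ = 1 := by rw [← hg.map_himp, himp_eq_one_iff.2 hle, hg.map_one]

/-- If `q` has a nonzero pseudocomplement, `q ^ n` and its complement split the hoop. -/
lemma himp_pow_mul_eq {B : Type u} [BddHoop B] [Finite B] {q u v : B} (hq : Maximal (· ≠ 1) q)
    {n : ℕ} (hn : q * q ^ n = q ^ n) (hk : q ^ n ⇨ ⊥ ≠ (⊥ : B)) (hu : q ⇨ u = u) :
    u ⇨ (q ^ n * v) = q ^ n * (u ⇨ v) := by
  have hee := pow_mul_eq_of_mul_eq hn n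
  set e := q ^ n with he
  have absorb : ∀ x ≤ e, e * x = x := fun x hx => by
    rw [← mul_himp_of_le hx, ← mul_assoc, hee]
  have hku : e ⇨ ⊥ ≤ u := by
    have := himp_mono_right (bot_le u) e
    rwa [pow_himp_eq hu] at this
  have hkq : ¬ e ⇨ ⊥ ≤ q := fun h => by
    have hfix : q ⇨ (e ⇨ ⊥) = e ⇨ (⊥ : B) := by rw [← mul_himp, hn]
    have hq' : q * (e ⇨ ⊥) = e ⇨ (⊥ : B) := by
      have := mul_himp_of_le h
      rwa [hfix] at this
    have h0 : e * (e ⇨ ⊥) = e ⇨ (⊥ : B) := pow_mul_eq_of_mul_eq hq' n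
    refine hk (le_antisymm ?_ (bot_le _))
    rw [← h0, mul_comm]
    exact himp_mul_le _ _
  have hue : u ⇨ e ≤ e := by
    rw [← himp_eq_one_iff]
    by_contra hy
    have h1 : e ≤ (u ⇨ e) ⇨ e := le_himp_self _ _
    have h2 : u ≤ (u ⇨ e) ⇨ e := le_himp (by rw [mul_comm]; exact himp_mul_le _ _)
    exact hkq ((hku.trans h2).trans (le_of_pow_le hq h1 hy))
  apply le_antisymm
  · rw [← absorb _ ((himp_mono_right (mul_le_left e v) u).trans hue)]
    exact mul_le_mul_left (himp_mono_right (mul_le_right e v) u) e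
  · refine le_himp ?_
    rw [mul_assoc]
    exact mul_le_mul_left (himp_mul_le u v) e

/-- Homomorphisms from an algebra with a homomorphism to `𝟐` lift along homomorphisms from finite
bounded hoops. -/
theorem exists_lift {φ : A → Prop} (hmul : ∀ a b, φ (a * b) ↔ φ a ∧ φ b)
    (himp : ∀ a b, φ (a ⇨ b) ↔ (φ a → φ b)) (hone : φ 1) (hbot : ¬ φ ⊥) {h : A → C}
    (hh : IsHom h) (m : ℕ) :
    ∀ (B : Type u) [BddHoop B] [Finite B], Nat.card B = m → ∀ g : B → C, IsHom g →
      (∀ a, ∃ b, g b = h a) → ∃ f : A → B, IsHom f ∧ ∀ a, g (f a) = h a := by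
  classical
  induction m using Nat.strong_induction_on with
  | _ m ih =>
  intro B _ _ hcard g hg hgh
  by_cases hi : Function.Injective g
  · choose f hf using hgh
    refine ⟨f, ⟨fun a b => hi ?_, fun a b => hi ?_, hi ?_, hi ?_⟩, hf⟩
    · rw [hf, hg.map_mul, hf, hf, hh.map_mul]
    · rw [hf, hg.map_himp, hf, hf, hh.map_himp]
    · rw [hf, hg.map_bot, hh.map_bot]
    · rw [hf, hg.map_one, hh.map_one]
  obtain ⟨q, hq, hgq⟩ := exists_maximal_of_not_injective hg hi
  obtain ⟨n, hn⟩ := exists_pow_absorbing q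
  have hee := pow_mul_eq_of_mul_eq hn n
  have hone_mul (b : B) : 1 * g b = g b := by rw [← hg.map_one, ← hg.map_mul, one_mul]
  have hone_himp (b : B) : 1 ⇨ g b = g b := by rw [← hg.map_one, ← hg.map_himp, one_himp]
  have hge : g (q ^ n) = 1 := by
    have hpow (k : ℕ) : g (q ^ k) = 1 := by
      induction k with
      | zero => rw [pow_zero, hg.map_one]
      | succ k ihk => rw [pow_succ', hg.map_mul, hgq, hone_mul, ihk]
    exact hpow n
  let _ := fixedBy hq hn
  have : Finite (FixedBy q) := Subtype.finite
  have hlt : Nat.card (FixedBy q) < m := by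
    rw [← hcard]
    refine Finite.card_subtype_lt (x := q) ?_
    rw [himp_self]
    exact hq.1.symm
  obtain ⟨f', hf', hgf'⟩ := ih _ hlt (FixedBy q) rfl (fun u => g u.1)
    ⟨fun a b => hg.map_mul a.1 b.1, fun a b => hg.map_himp a.1 b.1, by
      change g (q ^ n ⇨ ⊥) = ⊥
      rw [hg.map_himp, hge, hone_himp, hg.map_bot], hg.map_one⟩
    fun a => by
      obtain ⟨b, hb⟩ := hgh a
      refine ⟨⟨q ^ n ⇨ b, by rw [← mul_himp, hn]⟩, ?_⟩
      change g (q ^ n ⇨ b) = h a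
      rw [hg.map_himp, hge, hone_himp, hb]
  have fmul (a b : A) : (f' (a * b)).1 = (f' a).1 * (f' b).1 := congrArg Subtype.val (hf'.map_mul a b)
  have fhimp (a b : A) : (f' (a ⇨ b)).1 = (f' a).1 ⇨ (f' b).1 :=
    congrArg Subtype.val (hf'.map_himp a b)
  have fbot : (f' ⊥).1 = q ^ n ⇨ ⊥ := congrArg Subtype.val hf'.map_bot
  have fone : (f' 1).1 = 1 := congrArg Subtype.val hf'.map_one
  by_cases hk : q ^ n ⇨ ⊥ = (⊥ : B)
  · exact ⟨fun a => (f' a).1, ⟨fmul, fhimp, fbot.trans hk, fone⟩, hgf'⟩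
  have hfix (a : A) : q ^ n ⇨ (f' a).1 = (f' a).1 := pow_himp_eq (f' a).2 n
  have hefix (a : A) : q ^ n ⇨ (q ^ n * (f' a).1) = (f' a).1 := by
    refine le_antisymm ?_ (le_himp (mul_comm _ _).le)
    exact (himp_mono_right (mul_le_right _ _) _).trans (hfix a).le
  refine ⟨fun a => if φ a then (f' a).1 else q ^ n * (f' a).1, ⟨fun a b => ?_, fun a b => ?_, ?_, ?_⟩,
    fun a => ?_⟩
  · by_cases ha : φ a <;> by_cases hb : φ b <;> simp only [hmul, ha, hb, fmul, and_true, and_false,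
      if_true, if_false]
    · exact mul_left_comm _ _ _
    · exact (mul_assoc _ _ _).symm
    · rw [mul_mul_mul_comm, hee]
  · by_cases ha : φ a <;> by_cases hb : φ b <;> simp only [himp, ha, hb, fhimp, imp_true_iff,
      imp_false, not_true, not_false_iff, if_true, if_false]
    · exact (himp_pow_mul_eq hq hn hk (f' a).2).symm
    · rw [mul_himp, ← fhimp, hfix]
    · rw [mul_comm (q ^ n) (f' a).1, mul_himp, hefix]
  · simp only [hbot, if_false, fbot]
    exact le_antisymm (by rw [mul_comm]; exact himp_mul_le _ _) (bot_le _)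
  · simp only [hone, if_true, fone]
  · dsimp only
    split_ifs
    · exact hgf' a
    · rw [hg.map_mul, hge, hone_mul]
      exact hgf' a

end Lifting

end BddHoop

namespace UnivAlg

section Varieties

variable {L : FirstOrder.Language.{0, 0}}

lemma IsVariety.mem_of_injective {V : Set (Bundled.{u} L.Structure)} (hV : IsVariety V)
    {A B : Bundled.{u} L.Structure} (hB : B ∈ V) (f : A →[L] B) (hf : Function.Injective f) :
    A ∈ V := by
  obtain ⟨E, rfl⟩ := hV
  intro e he v
  apply hf
  rw [← FirstOrder.Language.HomClass.realize_term, ← FirstOrder.Language.HomClass.realize_term]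
  exact hB e he _

lemma IsVariety.mem_of_subsingleton {V : Set (Bundled.{u} L.Structure)} (hV : IsVariety V)
    (A : Bundled.{u} L.Structure) [Subsingleton A] : A ∈ V := by
  obtain ⟨E, rfl⟩ := hV
  exact fun e _ v => Subsingleton.elim _ _

/-- In a locally finite variety, projectivity of finite algebras can be tested on finite domains,
provided surjectivity is relaxed to an inclusion of ranges. -/
lemma IsVariety.isProjectiveIn {V : Set (Bundled.{u} L.Structure)} (hV : IsVariety V)
    (hfin : IsLocallyFinite V) {A : Bundled.{u} L.Structure} (hA : A ∈ V) [Finite A]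
    (H : ∀ B ∈ V, Finite B → ∀ C ∈ V, ∀ (h : A →[L] C) (g : B →[L] C), (∀ a, ∃ b, g b = h a) →
      ∃ f : A →[L] B, ∀ a, g (f a) = h a) : IsProjectiveIn V A := by
  refine ⟨hA, fun B hB C hC h g hg => ?_⟩
  choose b hb using fun a => hg (h a)
  let S : L.Substructure B := FirstOrder.Language.Substructure.closure L (Set.range b)
  have hS : (Bundled.of S : Bundled.{u} L.Structure) ∈ V :=
    hV.mem_of_injective hB (A := Bundled.of S) S.subtype.toHom Subtype.val_injective
  have hSfin : Finite S := hfin (Bundled.of S) hS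
    ((FirstOrder.Language.Substructure.fg_iff_structure_fg S).1
      (FirstOrder.Language.Substructure.fg_closure (Set.finite_range b)))
  obtain ⟨f, hf⟩ := H (Bundled.of S) hS hSfin C hC h (g.comp S.subtype.toHom) fun a =>
    ⟨⟨b a, FirstOrder.Language.Substructure.subset_closure ⟨a, rfl⟩⟩, hb a⟩
  exact ⟨S.subtype.toHom.comp f, hf⟩

/-- The one-element algebra. -/
def trivialAlg (L : FirstOrder.Language.{0, 0}) : Bundled.{u} L.Structure :=
  ⟨PUnit, ⟨fun _ _ => PUnit.unit, fun _ _ => True⟩⟩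

instance : Subsingleton (trivialAlg L) := inferInstanceAs (Subsingleton PUnit)

/-- A structure on `Bool`, lifted to an arbitrary universe. -/
def boolAlg (L : FirstOrder.Language.{0, 0}) [L.Structure Bool] : Bundled.{u} L.Structure :=
  ⟨ULift Bool, Equiv.ulift.symm.inducedStructure⟩

/-- The isomorphism between `Bool` and its lift. -/
def boolEquiv (L : FirstOrder.Language.{0, 0}) [L.Structure Bool] : Bool ≃[L] boolAlg.{u} L :=
  Equiv.ulift.symm.inducedStructureEquiv

lemma IsProjectiveIn.exists_hom_bool [L.Structure Bool] {K : Set (Bundled.{u} L.Structure)}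
    {A : Bundled.{u} L.Structure} (hA : IsProjectiveIn K A) (h₁ : trivialAlg L ∈ K)
    (h₂ : boolAlg L ∈ K) : Nonempty (A →[L] Bool) := by
  let t (B : Bundled.{u} L.Structure) : B →[L] trivialAlg.{u} L :=
    { toFun := fun _ => PUnit.unit
      map_fun' := fun _ _ => rfl
      map_rel' := fun _ _ _ => trivial }
  obtain ⟨f, -⟩ := hA.2 _ h₂ _ h₁ (t A) (t _) fun x => ⟨(boolEquiv L) true, Subsingleton.elim _ _⟩
  exact ⟨(boolEquiv.{u} L).symm.toHom.comp f⟩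

end Varieties

end UnivAlg

namespace Hoop

section Operations

variable {L : FirstOrder.Language.{0, 0}} {A B : Type*} [L.Structure A] [L.Structure B]

lemma map_op₂ (f : A →[L] B) (s : L.Functions 2) (a b : A) :
    f (op₂ A s a b) = op₂ B s (f a) (f b) := by
  rw [op₂, f.map_fun, op₂]
  congr 1
  ext i
  fin_cases i <;> rfl

lemma map_op₀ (f : A →[L] B) (s : L.Functions 0) : f (op₀ A s) = op₀ B s := by
  rw [op₀, f.map_fun, op₀]
  congr 1
  ext i
  exact i.elim0

lemma map_funMap_two {f : A → B} {s : L.Functions 2}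
    (h : ∀ a b, f (op₂ A s a b) = op₂ B s (f a) (f b)) (x : Fin 2 → A) :
    f (FirstOrder.Language.Structure.funMap s x) =
      FirstOrder.Language.Structure.funMap s (f ∘ x) := by
  have h₁ : x = ![x 0, x 1] := by ext i; fin_cases i <;> rfl
  have h₂ : f ∘ x = ![f (x 0), f (x 1)] := by ext i; fin_cases i <;> rfl
  rw [h₂]
  conv_lhs => rw [h₁]
  exact h _ _

lemma map_funMap_zero {f : A → B} {s : L.Functions 0} (h : f (op₀ A s) = op₀ B s) (x : Fin 0 → A) :
    f (FirstOrder.Language.Structure.funMap s x) =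
      FirstOrder.Language.Structure.funMap s (f ∘ x) := by
  obtain rfl := Subsingleton.elim ![] x
  rw [Subsingleton.elim (f ∘ ![]) (![])]
  exact h

end Operations

/-- Maps preserving the operations of bounded hoops. -/
structure PreservesOps {A B : Type*} (inf mul imp : A → A → A) (zero one : A) (infB mulB impB : B → B → B)
    (zeroB oneB : B) (f : A → B) : Prop where
  map_inf (a b : A) : f (inf a b) = infB (f a) (f b)
  map_mul (a b : A) : f (mul a b) = mulB (f a) (f b)
  map_imp (a b : A) : f (imp a b) = impB (f a) (f b)
  map_zero : f zero = zeroB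
  map_one : f one = oneB

section Laws

variable {A : Type u} {inf sup mul imp : A → A → A} {zero one : A}

/-- The bounded hoop determined by operations satisfying the laws. -/
@[reducible] def BoundedHoopLaws.toBddHoop (h : BoundedHoopLaws inf mul imp zero one) :
    BddHoop A where
  mul := mul
  one := one
  mul_assoc := h.mul_assoc
  mul_comm := h.mul_comm
  mul_one := h.mul_one
  one_mul a := (h.mul_comm one a).trans (h.mul_one a)
  le a b := inf a b = a
  le_refl := h.inf_idem
  le_trans a b c hab hbc := by
    rw [← hab, h.inf_assoc, hbc]
  le_antisymm a b hab hba := by rw [← hab, h.inf_comm]; exact hba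
  himp := imp
  bot := zero
  le_one := h.le_one
  bot_le := h.zero_le
  mul_le_iff := h.residuation
  mul_himp_comm := h.divisibility

lemma BoundedHoopLaws.inf_eq (h : BoundedHoopLaws inf mul imp zero one) (a b : A) :
    inf a b = mul a (imp a b) := by
  let _ := h.toBddHoop
  have h₁ : inf a b ≤ a := by
    change inf (inf a b) a = inf a b
    rw [h.inf_comm a b, h.inf_assoc, h.inf_idem]
  have h₂ : inf a b ≤ b := by
    change inf (inf a b) b = inf a b
    rw [h.inf_assoc, h.inf_idem]
  have h₃ : a * (a ⇨ b) ≤ inf a b := by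
    have h₄ : a * (a ⇨ b) ≤ b := by rw [_root_.mul_comm]; exact BddHoop.himp_mul_le a b
    have h₅ : inf (a * (a ⇨ b)) a = a * (a ⇨ b) := BddHoop.mul_le_left a (a ⇨ b)
    have h₆ : inf (a * (a ⇨ b)) b = a * (a ⇨ b) := h₄
    change inf (a * (a ⇨ b)) (inf a b) = a * (a ⇨ b)
    rw [← h.inf_assoc, h₅, h₆]
  refine le_antisymm ?_ h₃
  rw [← BddHoop.mul_himp_of_le h₁]
  exact BddHoop.mul_le_mul_left (BddHoop.himp_mono_right h₂ a) a

lemma BLLaws.sup_eq (h : BLLaws inf sup mul imp zero one) (a b : A) :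
    sup a b = inf (imp (imp a b) b) (imp (imp b a) a) := by
  let _ := h.toBoundedHoopLaws.toBddHoop
  have le_sup (x y : A) : x ≤ sup x y := h.inf_sup_self x y
  have le_sup' (x y : A) : y ≤ sup x y := by rw [h.sup_comm]; exact le_sup y x
  have sup_le {x y z : A} (hx : x ≤ z) (hy : y ≤ z) : sup x y ≤ z := by
    have aux {w : A} (hw : w ≤ z) : sup z w = z := by
      have := h.sup_inf_self z w
      rwa [h.inf_comm, show inf w z = w from hw] at this
    have : sup z (sup x y) = z := by rw [← h.sup_assoc, aux hx, aux hy]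
    rw [← this]
    exact le_sup' _ _
  have le_inf {x y z : A} (hx : x ≤ y) (hz : x ≤ z) : x ≤ inf y z := by
    change inf x (inf y z) = x
    rw [← h.inf_assoc, show inf x y = x from hx, show inf x z = x from hz]
  have inf_le_left (x y : A) : inf x y ≤ x := by
    change inf (inf x y) x = inf x y
    rw [h.inf_comm x y, h.inf_assoc, h.inf_idem]
  have inf_le_right (x y : A) : inf x y ≤ y := by
    rw [h.inf_comm]; exact inf_le_left y x
  have le_himp_himp (x y : A) : x ≤ (x ⇨ y) ⇨ y :=
    BddHoop.le_himp (by rw [_root_.mul_comm]; exact BddHoop.himp_mul_le x y)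
  apply le_antisymm
  · exact sup_le (le_inf (le_himp_himp a b) (BddHoop.le_himp_self (b ⇨ a) a))
      (le_inf (BddHoop.le_himp_self (a ⇨ b) b) (le_himp_himp b a))
  · set z := inf (imp (imp a b) b) (imp (imp b a) a) with hz
    have h₁ : (a ⇨ b) ≤ z ⇨ sup a b := BddHoop.le_himp (by
      rw [_root_.mul_comm]
      exact (BddHoop.mul_le_of_le_himp (inf_le_left _ _)).trans (le_sup' a b))
    have h₂ : (b ⇨ a) ≤ z ⇨ sup a b := BddHoop.le_himp (by
      rw [_root_.mul_comm]
      exact (BddHoop.mul_le_of_le_himp (inf_le_right _ _)).trans (le_sup a b))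
    have h₃ : (1 : A) ≤ z ⇨ sup a b := by
      have := sup_le h₁ h₂
      rwa [show sup (a ⇨ b) (b ⇨ a) = 1 from h.prelinearity a b] at this
    exact BddHoop.himp_eq_one_iff.1 (le_antisymm (BddHoop.le_one _) h₃)

variable {B C : Type u} {infB mulB impB : B → B → B} {zeroB oneB : B}
  {infC mulC impC : C → C → C} {zeroC oneC : C}

lemma PreservesOps.map_sup {A B : Type*} {inf sup mul imp : A → A → A} {zero one : A}
    {infB supB mulB impB : B → B → B} {zeroB oneB : B} {f : A → B}
    (hf : PreservesOps inf mul imp zero one infB mulB impB zeroB oneB f)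
    (hA : BLLaws inf sup mul imp zero one) (hB : BLLaws infB supB mulB impB zeroB oneB) (a b : A) :
    f (sup a b) = supB (f a) (f b) := by
  rw [hA.sup_eq, hB.sup_eq, hf.map_inf, hf.map_imp, hf.map_imp, hf.map_imp, hf.map_imp]

lemma PreservesOps.exists_lift [Finite B] (hA : BoundedHoopLaws inf mul imp zero one)
    (hB : BoundedHoopLaws infB mulB impB zeroB oneB)
    (hC : BoundedHoopLaws infC mulC impC zeroC oneC) {φ : A → Bool}
    (hφ : PreservesOps inf mul imp zero one (· && ·) (· && ·) (! · || ·) false true φ)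
    {h : A → C} (hh : PreservesOps inf mul imp zero one infC mulC impC zeroC oneC h)
    {g : B → C} (hg : PreservesOps infB mulB impB zeroB oneB infC mulC impC zeroC oneC g)
    (hgh : ∀ a, ∃ b, g b = h a) :
    ∃ f : A → B, PreservesOps inf mul imp zero one infB mulB impB zeroB oneB f ∧
      ∀ a, g (f a) = h a := by
  let _ := hA.toBddHoop
  let _ := hB.toBddHoop
  let _ := hC.toBddHoop
  obtain ⟨f, hf, hgf⟩ := BddHoop.exists_lift (A := A) (C := C) (φ := fun a => φ a = true)
    (fun a b => by rw [show φ (a * b) = _ from hφ.map_mul a b]; simp)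
    (fun a b => by
      rw [show φ (a ⇨ b) = _ from hφ.map_imp a b]
      cases φ a <;> cases φ b <;> simp)
    hφ.map_one (by rw [show φ ⊥ = _ from hφ.map_zero]; simp)
    (h := h) ⟨hh.map_mul, hh.map_imp, hh.map_zero, hh.map_one⟩ _ B rfl g
    ⟨hg.map_mul, hg.map_imp, hg.map_zero, hg.map_one⟩ hgh
  refine ⟨f, ⟨fun a b => ?_, hf.map_mul, hf.map_himp, hf.map_bot, hf.map_one⟩, hgf⟩
  rw [hA.inf_eq, hB.inf_eq]
  exact (hf.map_mul _ _).trans (congrArg _ (hf.map_himp a b))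

lemma BoundedHoopLaws.zero_ne_one [Nontrivial A] (h : BoundedHoopLaws inf mul imp zero one) :
    zero ≠ one := by
  intro h01
  obtain ⟨a, b, hab⟩ := exists_pair_ne A
  have aux (x : A) : x = zero := by
    rw [← h.le_one x, ← h01, h.inf_comm, h.zero_le]
  exact hab ((aux a).trans (aux b).symm)

/-- The two constants of a bounded hoop are closed under the operations, with the values of the
two-element Boolean algebra. -/
lemma BoundedHoopLaws.preservesOps_cond (h : BoundedHoopLaws inf mul imp zero one) :
    PreservesOps (· && ·) (· && ·) (! · || ·) false true inf mul imp zero one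
      (fun b => cond b one zero) := by
  let _ := h.toBddHoop
  have hinf (x : A) : inf one x = x := by rw [h.inf_comm, h.le_one]
  have hmul (x : A) : mul zero x = zero := le_antisymm (BddHoop.mul_le_left ⊥ x) (h.zero_le _)
  have himp (x : A) : imp zero x = one := BddHoop.himp_eq_one_iff.2 (h.zero_le x)
  have himp' (x : A) : imp one x = x := BddHoop.one_himp x
  refine ⟨?_, ?_, ?_, rfl, rfl⟩ <;> intro a b <;> cases a <;> cases b <;>
    simp [hinf, h.zero_le, hmul, himp, himp', h.mul_one]
  rw [h.mul_comm, hmul]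

lemma boundedHoopLaws_bool :
    BoundedHoopLaws (· && ·) (· && ·) (fun a b : Bool => !a || b) false true := by
  constructor <;> decide

lemma BLLaws.map_sup_cond (h : BLLaws inf sup mul imp zero one) (a b : Bool) :
    cond (a || b) one zero = sup (cond a one zero) (cond b one zero) := by
  have hb : BLLaws (· && ·) (· || ·) (· && ·) (fun a b : Bool => !a || b) false true :=
    { boundedHoopLaws_bool with
      sup_assoc := by decide
      sup_comm := by decide
      inf_sup_self := by decide
      sup_inf_self := by decide
      prelinearity := by decide }
  exact (h.preservesOps_cond).map_sup hb h a b

end Laws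

section Homs

/-- Homomorphisms preserve the operations of bounded hoops. -/
lemma preservesOps_hoop {A B : Type*} [hoopLang.Structure A] [hoopLang.Structure B]
    (f : A →[hoopLang] B) :
    PreservesOps (op₂ (L := hoopLang) A HoopFun.inf) (op₂ (L := hoopLang) A HoopFun.mul)
      (op₂ (L := hoopLang) A HoopFun.imp) (op₀ (L := hoopLang) A HoopFun.zero)
      (op₀ (L := hoopLang) A HoopFun.one) (op₂ (L := hoopLang) B HoopFun.inf)
      (op₂ (L := hoopLang) B HoopFun.mul) (op₂ (L := hoopLang) B HoopFun.imp)
      (op₀ (L := hoopLang) B HoopFun.zero) (op₀ (L := hoopLang) B HoopFun.one) f :=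
  ⟨map_op₂ f _, map_op₂ f _, map_op₂ f _, map_op₀ f _, map_op₀ f _⟩

lemma preservesOps_bl {A B : Type*} [blLang.Structure A] [blLang.Structure B] (f : A →[blLang] B) :
    PreservesOps (op₂ (L := blLang) A BLFun.inf) (op₂ (L := blLang) A BLFun.mul)
      (op₂ (L := blLang) A BLFun.imp) (op₀ (L := blLang) A BLFun.zero)
      (op₀ (L := blLang) A BLFun.one) (op₂ (L := blLang) B BLFun.inf)
      (op₂ (L := blLang) B BLFun.mul) (op₂ (L := blLang) B BLFun.imp)
      (op₀ (L := blLang) B BLFun.zero) (op₀ (L := blLang) B BLFun.one) f :=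
  ⟨map_op₂ f _, map_op₂ f _, map_op₂ f _, map_op₀ f _, map_op₀ f _⟩

/-- The homomorphism of bounded hoops given by a map preserving the operations. -/
def hoopHom {A B : Type*} [hoopLang.Structure A] [hoopLang.Structure B] {f : A → B}
    (hf : PreservesOps (op₂ (L := hoopLang) A HoopFun.inf) (op₂ (L := hoopLang) A HoopFun.mul)
      (op₂ (L := hoopLang) A HoopFun.imp) (op₀ (L := hoopLang) A HoopFun.zero)
      (op₀ (L := hoopLang) A HoopFun.one) (op₂ (L := hoopLang) B HoopFun.inf)
      (op₂ (L := hoopLang) B HoopFun.mul) (op₂ (L := hoopLang) B HoopFun.imp)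
      (op₀ (L := hoopLang) B HoopFun.zero) (op₀ (L := hoopLang) B HoopFun.one) f) :
    A →[hoopLang] B where
  toFun := f
  map_fun' {_} s x := match s, x with
    | HoopFun.zero, x => map_funMap_zero (L := hoopLang) hf.map_zero x
    | HoopFun.one, x => map_funMap_zero (L := hoopLang) hf.map_one x
    | HoopFun.inf, x => map_funMap_two (L := hoopLang) hf.map_inf x
    | HoopFun.mul, x => map_funMap_two (L := hoopLang) hf.map_mul x
    | HoopFun.imp, x => map_funMap_two (L := hoopLang) hf.map_imp x
  map_rel' r := r.elim

/-- The homomorphism of BL-algebras given by a map preserving the operations. -/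
def blHom {A B : Type*} [blLang.Structure A] [blLang.Structure B] {f : A → B}
    (hf : PreservesOps (op₂ (L := blLang) A BLFun.inf) (op₂ (L := blLang) A BLFun.mul)
      (op₂ (L := blLang) A BLFun.imp) (op₀ (L := blLang) A BLFun.zero)
      (op₀ (L := blLang) A BLFun.one) (op₂ (L := blLang) B BLFun.inf)
      (op₂ (L := blLang) B BLFun.mul) (op₂ (L := blLang) B BLFun.imp)
      (op₀ (L := blLang) B BLFun.zero) (op₀ (L := blLang) B BLFun.one) f)
    (hsup : ∀ a b, f (op₂ (L := blLang) A BLFun.sup a b) =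
      op₂ (L := blLang) B BLFun.sup (f a) (f b)) :
    A →[blLang] B where
  toFun := f
  map_fun' {_} s x := match s, x with
    | BLFun.zero, x => map_funMap_zero (L := blLang) hf.map_zero x
    | BLFun.one, x => map_funMap_zero (L := blLang) hf.map_one x
    | BLFun.inf, x => map_funMap_two (L := blLang) hf.map_inf x
    | BLFun.sup, x => map_funMap_two (L := blLang) hsup x
    | BLFun.mul, x => map_funMap_two (L := blLang) hf.map_mul x
    | BLFun.imp, x => map_funMap_two (L := blLang) hf.map_imp x
  map_rel' r := r.elim

lemma surjective_of_map_constants {A : Type*} {f : A → Bool} {a b : A} (ha : f a = false)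
    (hb : f b = true) : Function.Surjective f
  | false => ⟨a, ha⟩
  | true => ⟨b, hb⟩

lemma hoop_surjective {A : Type*} [hoopLang.Structure A] (φ : A →[hoopLang] Bool) :
    Function.Surjective φ :=
  surjective_of_map_constants (preservesOps_hoop φ).map_zero (preservesOps_hoop φ).map_one

lemma bl_surjective {A : Type*} [blLang.Structure A] (φ : A →[blLang] Bool) :
    Function.Surjective φ :=
  surjective_of_map_constants (preservesOps_bl φ).map_zero (preservesOps_bl φ).map_one

lemma exists_hoop_lift {A B C : Bundled.{u} hoopLang.Structure} (hA : A ∈ boundedHoops)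
    (hB : B ∈ boundedHoops) (hC : C ∈ boundedHoops) [Finite B] (φ : A →[hoopLang] Bool)
    (h : A →[hoopLang] C) (g : B →[hoopLang] C) (hgh : ∀ a, ∃ b, g b = h a) :
    ∃ f : A →[hoopLang] B, ∀ a, g (f a) = h a := by
  obtain ⟨f, hf, hgf⟩ := PreservesOps.exists_lift hA hB hC (preservesOps_hoop φ)
    (preservesOps_hoop h) (preservesOps_hoop g) hgh
  exact ⟨hoopHom hf, hgf⟩

lemma exists_bl_lift {A B C : Bundled.{u} blLang.Structure} (hA : A ∈ blAlgebras)
    (hB : B ∈ blAlgebras) (hC : C ∈ blAlgebras) [Finite B] (φ : A →[blLang] Bool)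
    (h : A →[blLang] C) (g : B →[blLang] C) (hgh : ∀ a, ∃ b, g b = h a) :
    ∃ f : A →[blLang] B, ∀ a, g (f a) = h a := by
  obtain ⟨f, hf, hgf⟩ := PreservesOps.exists_lift hA.toBoundedHoopLaws hB.toBoundedHoopLaws
    hC.toBoundedHoopLaws (preservesOps_bl φ) (preservesOps_bl h) (preservesOps_bl g) hgh
  exact ⟨blHom hf (hf.map_sup hA hB), hgf⟩

lemma cond_injective {A : Type*} {a b : A} (h : a ≠ b) :
    Function.Injective fun c : Bool => cond c b a := by
  intro c d
  cases c <;> cases d <;> simp [h, h.symm]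

lemma boolAlg_mem_of_boundedHoops {V : Set (Bundled.{u} hoopLang.Structure)} (hV : IsVariety V)
    (hsub : V ⊆ boundedHoops) (hnt : ∃ B ∈ V, Nontrivial B) : boolAlg hoopLang ∈ V := by
  obtain ⟨B, hB, hBn⟩ := hnt
  have hb : BoundedHoopLaws _ _ _ _ _ := hsub hB
  exact hV.mem_of_injective hB
    ((hoopHom (A := Bool) hb.preservesOps_cond).comp (boolEquiv hoopLang).symm.toHom)
    ((cond_injective hb.zero_ne_one).comp (boolEquiv hoopLang).symm.injective)

lemma boolAlg_mem_of_blAlgebras {V : Set (Bundled.{u} blLang.Structure)} (hV : IsVariety V)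
    (hsub : V ⊆ blAlgebras) (hnt : ∃ B ∈ V, Nontrivial B) : boolAlg blLang ∈ V := by
  obtain ⟨B, hB, hBn⟩ := hnt
  have hb : BLLaws _ _ _ _ _ _ := hsub hB
  exact hV.mem_of_injective hB
    ((blHom (A := Bool) hb.preservesOps_cond hb.map_sup_cond).comp (boolEquiv blLang).symm.toHom)
    ((cond_injective hb.zero_ne_one).comp (boolEquiv blLang).symm.injective)

lemma trivialAlg_mem_boundedHoops : trivialAlg.{u} hoopLang ∈ boundedHoops := by
  constructor <;> intros <;> first | exact Subsingleton.elim _ _ |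
    exact iff_of_true (Subsingleton.elim _ _) (Subsingleton.elim _ _)

/-- The laws of bounded hoops pull back along injective homomorphisms. -/
lemma BoundedHoopLaws.of_injective {A B : Type*} {inf mul imp : A → A → A} {zero one : A}
    {infB mulB impB : B → B → B} {zeroB oneB : B} {f : A → B}
    (hf : PreservesOps inf mul imp zero one infB mulB impB zeroB oneB f)
    (hi : Function.Injective f) (h : BoundedHoopLaws infB mulB impB zeroB oneB) :
    BoundedHoopLaws inf mul imp zero one := by
  constructor <;> intros <;>
    simp only [← hi.eq_iff, hf.map_inf, hf.map_mul, hf.map_imp, hf.map_zero, hf.map_one]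
  · exact h.inf_assoc _ _ _
  · exact h.inf_comm _ _
  · exact h.inf_idem _
  · exact h.le_one _
  · exact h.zero_le _
  · exact h.mul_assoc _ _ _
  · exact h.mul_comm _ _
  · exact h.mul_one _
  · exact h.residuation _ _ _
  · exact h.divisibility _ _

lemma boolAlg_mem_boundedHoops : boolAlg.{u} hoopLang ∈ boundedHoops :=
  BoundedHoopLaws.of_injective (preservesOps_hoop (boolEquiv.{u} hoopLang).symm.toHom)
    (boolEquiv hoopLang).symm.injective boundedHoopLaws_bool

end Homs

end Hoop

theorem mainTheorem3 :
    -- finite bounded hoops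
    (∀ A : Bundled.{u} hoopLang.Structure, A ∈ boundedHoops → Finite A →
      (IsFinitelyProjectiveIn boundedHoops A ↔
        ∃ φ : A →[hoopLang] Bool, Function.Surjective φ)) ∧
    -- locally finite nontrivial varieties of bounded hoops
    (∀ V : Set (Bundled.{u} hoopLang.Structure), IsVariety V → V ⊆ boundedHoops →
      IsLocallyFinite V → (∃ B ∈ V, Nontrivial B) →
      ∀ A ∈ V, Finite A →
        (IsProjectiveIn V A ↔ ∃ φ : A →[hoopLang] Bool, Function.Surjective φ)) ∧
    -- locally finite nontrivial varieties of BL-algebras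
    (∀ V : Set (Bundled.{u} blLang.Structure), IsVariety V → V ⊆ blAlgebras →
      IsLocallyFinite V → (∃ B ∈ V, Nontrivial B) →
      ∀ A ∈ V, Finite A →
        (IsProjectiveIn V A ↔ ∃ φ : A →[blLang] Bool, Function.Surjective φ)) := by
  refine ⟨fun A hA hAf => ⟨fun hp => ?_, ?_⟩, fun V hV hsub hfin hnt A hA hAf => ⟨fun hp => ?_, ?_⟩,
    fun V hV hsub hfin hnt A hA hAf => ⟨fun hp => ?_, ?_⟩⟩
  · obtain ⟨φ⟩ := hp.exists_hom_bool
      ⟨trivialAlg_mem_boundedHoops, inferInstanceAs (Finite PUnit)⟩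
      ⟨boolAlg_mem_boundedHoops, inferInstanceAs (Finite (ULift Bool))⟩
    exact ⟨φ, hoop_surjective φ⟩
  · rintro ⟨φ, -⟩
    refine ⟨⟨hA, hAf⟩, fun B hB C hC h g hg => ?_⟩
    have := hB.2
    exact exists_hoop_lift hA hB.1 hC.1 φ h g fun a => hg (h a)
  · obtain ⟨φ⟩ := hp.exists_hom_bool (hV.mem_of_subsingleton _)
      (boolAlg_mem_of_boundedHoops hV hsub hnt)
    exact ⟨φ, hoop_surjective φ⟩
  · rintro ⟨φ, -⟩
    exact hV.isProjectiveIn hfin hA fun B hB _ C hC h g hgh =>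
      exists_hoop_lift (hsub hA) (hsub hB) (hsub hC) φ h g hgh
  · obtain ⟨φ⟩ := hp.exists_hom_bool (hV.mem_of_subsingleton _)
      (boolAlg_mem_of_blAlgebras hV hsub hnt)
    exact ⟨φ, bl_surjective φ⟩
  · rintro ⟨φ, -⟩
    exact hV.isProjectiveIn hfin hA fun B hB _ C hC h g hgh =>
      exists_bl_lift (hsub hA) (hsub hB) (hsub hC) φ h g hgh
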